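/- Let $(\Omega,\mathcal M,P)$ be a probability space with filtrations $\mathbb F=(\mathcal F_t)_{t\ge 0}$ and $\mathbb G=(\mathcal G_t)_{t\ge 0}$, both satisfying the usual hypotheses (right-continuity, and all $P$-null sets belong to the initial $\sigma$-algebra), with $\mathcal F_t\subseteq\mathcal G_t$ for all $t$. Let $c:[0,\infty)\to\mathbb R$ be a deterministic, continuous, nondecreasing function, and let $\lambda=(\lambda_s)_{s\ge 0}$ be a jointly measurable $\mathbb G$-adapted process with values in $[0,\infty]$. Let $R:\Omega\to[0,\infty]$ be a $\mathbb G$-stopping time which is also an $\mathbb F$-stopping time. For a filtration $\mathbb H$, the $\mathbb H$-compensator of $R$ is the $\mathbb H$-predictable process $A$ which, almost surely, has finite, nondecreasing, right-continuous paths with $A_0=0$, and for which $1_{\{t\ge R\}}-A_t$ is an $\mathbb H$-martingale. The optional projection of $\lambda$ onto $\mathbb F$ is the $[0,\infty]$-valued process ${}^o\lambda$ that is measurable for the optional $\sigma$-algebra of $\mathbb F$ (generated by the $\mathbb F$-adapted càdlàg processes) and satisfies ${}^o\lambda_T 1_{\{T<\infty\}}=E[\lambda_T1_{\{T<\infty\}}\mid\mathcal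 F_T]$ a.s. for every $\mathbb F$-stopping time $T$. Suppose that the $\mathbb G$-compensator of $R$ is $\int_0^t\lambda_s\,dc(s)$. Then the optional projection ${}^o\lambda$ of $\lambda$ onto $\mathbb F$ exists, and (for every version of it) the $\mathbb F$-compensator of $R$ is $\int_0^t{}^o\lambda_s\,dc(s)$. In particular, $1_{\{t\ge R\}}-\int_0^t{}^o\lambda_s\,dc(s)$ is an $\mathbb F$-martingale. -/

import Mathlib

open MeasureTheory Filter Topology
open scoped NNReal ENNReal

namespace StoppingCompensator

variable {Ω : Type*} {m : MeasurableSpace Ω}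

/-- The usual hypotheses: the filtration is right-continuous, and its initial σ-algebra contains
every `P`-null subset of `Ω` (in particular the probability space is complete). -/
structure UsualHypotheses (𝓕 : Filtration ℝ≥0 m) (P : Measure Ω) : Prop where
  rightContinuous : 𝓕.IsRightContinuous
  complete : ∀ s : Set Ω, P s = 0 → MeasurableSet[𝓕 0] s

/-- A path `x : [0, ∞) → ℝ` is càdlàg: right-continuous with finite left limits. -/
def IsCadlag (x : ℝ≥0 → ℝ) : Prop :=
  ∀ t, ContinuousWithinAt x (Set.Ici t) t ∧ ∃ l : ℝ, Tendsto x (𝓝[<] t) (𝓝 l)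

/-- The optional σ-algebra on `[0, ∞) × Ω`: the smallest σ-algebra for which all adapted real
processes with càdlàg paths are measurable. -/
@[reducible]
def optional (𝓕 : Filtration ℝ≥0 m) : MeasurableSpace (ℝ≥0 × Ω) :=
  ⨆ (X : ℝ≥0 → Ω → ℝ) (_ : Adapted 𝓕 X ∧ ∀ ω, IsCadlag fun t ↦ X t ω),
    MeasurableSpace.comap (Function.uncurry X) inferInstance

/-- The variable equal to `X_T` on `{T < ∞}` and to `0` on `{T = ∞}`. -/
noncomputable def valueAt (X : ℝ≥0 → Ω → ℝ≥0∞) (T : Ω → WithTop ℝ≥0) : Ω → ℝ≥0∞ :=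
  {ω | T ω < ⊤}.indicator (stoppedValue X T)

/-- `Y` is (a version of) the optional projection of the nonnegative process `X` onto `𝓕`: it is
optional, and `Y_T 1_{T < ∞} = E[X_T 1_{T < ∞} | 𝓕_T]` a.s. for every `𝓕`-stopping time `T`. -/
structure IsOptionalProjection (𝓕 : Filtration ℝ≥0 m) (P : Measure Ω)
    (X Y : ℝ≥0 → Ω → ℝ≥0∞) : Prop where
  optional : Measurable[optional 𝓕] (Function.uncurry Y)
  condExp : ∀ (T : Ω → WithTop ℝ≥0) (hT : IsStoppingTime 𝓕 T),
    valueAt Y T =ᵐ[P] condLExp hT.measurableSpace P (valueAt X T)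

/-- The process `1_{t ≥ R}`. -/
noncomputable def jumpProcess (R : Ω → WithTop ℝ≥0) : ℝ≥0 → Ω → ℝ :=
  fun t ↦ {ω | R ω ≤ t}.indicator 1

/-- `A` is the `𝓕`-compensator of the random time `R`: it is predictable, almost surely its paths
are finite, start from `0`, are nondecreasing and right-continuous, and `1_{t ≥ R} - A_t` is
an `𝓕`-martingale. -/
structure IsCompensator (𝓕 : Filtration ℝ≥0 m) (P : Measure Ω) (R : Ω → WithTop ℝ≥0)
    (A : ℝ≥0 → Ω → ℝ≥0∞) : Prop where
  predictable : IsStronglyPredictable 𝓕 A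
  finite : ∀ᵐ ω ∂P, ∀ t, A t ω < ∞
  zero : ∀ᵐ ω ∂P, A 0 ω = 0
  mono : ∀ᵐ ω ∂P, Monotone fun t ↦ A t ω
  rightContinuous : ∀ᵐ ω ∂P, ∀ t, ContinuousWithinAt (fun s ↦ A s ω) (Set.Ici t) t
  martingale : Martingale (fun t ω ↦ jumpProcess R t ω - (A t ω).toReal) 𝓕 P

/-- The measure `dc` on `[0, ∞)`, with `dc((a, b]) = c b - c a`, and no mass at `0`. -/
noncomputable def clockMeasure (c : ℝ≥0 → ℝ) (hc : Continuous c) (hmono : Monotone c) :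
    Measure ℝ≥0 :=
  StieltjesFunction.measure ⟨c, hmono, fun _ ↦ hc.continuousWithinAt⟩

/-- The process `t ↦ ∫_0^t X_s dμ(s)`, with values in `[0, ∞]`. -/
noncomputable def cumulative (X : ℝ≥0 → Ω → ℝ≥0∞) (μ : Measure ℝ≥0) : ℝ≥0 → Ω → ℝ≥0∞ :=
  fun t ω ↦ ∫⁻ s in Set.Ioc 0 t, X s ω ∂μ

end StoppingCompensator

/-! Because the clock `c` is deterministic, the compensator statement reduces to Tonelli. For `s ≤
t` and `B ∈ 𝓕_s`, both `E[1_B ∫_(s,t] ᵒλ dc]` and `E[1_B ∫_(s,t] λ dc]` are `dc`-integrals over `u`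
of `E[1_B ᵒλ_u] = E[1_B λ_u]`, the projection property being needed only at constant times
(`IsOptionalProjection.setLIntegral_increment_eq`). Since `B ∈ 𝓖_s` as well, the `𝓖`-martingale
identity on `B` becomes the `𝓕`-martingale identity
(`IsOptionalProjection.isCompensator_cumulative`). Continuity of `c` makes the new integral
left-continuous, hence predictable (`isStronglyPredictable_cumulative`).

Existence of the projection is the longer half. For the indicator of `[a, ∞) × B` it is `1_{[a, ∞)}
M`, with `M` a càdlàg version of `E[1_B | 𝓕_t]` (`exists_cadlag_projection`). Doob's upcrossing
inequality gives one-sided limits along the rationals almost surely, completeness of `𝓕_0` allows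
the bad paths to be set to zero, right-continuity of `𝓕` keeps the right limits adapted, and
approximating a stopping time from the right by countably valued times gives optional stopping. A
π-λ argument and series of simple functions then reach every jointly measurable process. -/

namespace StoppingCompensator

variable {Ω : Type*} {m : MeasurableSpace Ω}

/-! ### Paths and their upcrossings along the rationals -/

/-- The nonnegative rationals, as a subset of `ℝ≥0`. -/
def rationals : Set ℝ≥0 := {x | ∃ k n : ℕ, x = k / (n + 1)}

lemma countable_rationals : rationals.Countable := by
  have : rationals = Set.range fun p : ℕ × ℕ ↦ ((p.1 : ℝ≥0) / (p.2 + 1)) := by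
    ext x
    simp [rationals, eq_comm]
  rw [this]
  exact Set.countable_range _

/-- The first multiple of `1 / (n + 1)` that is strictly larger than `t`. -/
noncomputable def gridSucc (n : ℕ) (t : ℝ≥0) : ℝ≥0 := (⌊(n + 1) * t⌋₊ + 1 : ℕ) / (n + 1)

lemma gridSucc_mem (n : ℕ) (t : ℝ≥0) : gridSucc n t ∈ rationals := ⟨_, n, rfl⟩

lemma lt_gridSucc (n : ℕ) (t : ℝ≥0) : t < gridSucc n t := by
  rw [gridSucc, lt_div_iff₀ (by positivity), mul_comm]
  exact_mod_cast Nat.lt_floor_add_one ((n + 1) * t)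

lemma gridSucc_le (n : ℕ) (t : ℝ≥0) : gridSucc n t ≤ t + 1 / (n + 1) := by
  rw [gridSucc, div_le_iff₀ (by positivity), add_mul t, div_mul_cancel₀ _ (by positivity), mul_comm t]
  push_cast
  gcongr
  exact Nat.floor_le (by positivity)

lemma tendsto_gridSucc (t : ℝ≥0) : Tendsto (fun n ↦ gridSucc n t) atTop (𝓝 t) := by
  refine tendsto_of_tendsto_of_tendsto_of_le_of_le tendsto_const_nhds ?_
    (fun n ↦ (lt_gridSucc n t).le) (fun n ↦ gridSucc_le n t)
  have : Tendsto (fun n : ℕ ↦ (1 : ℝ≥0) / (n + 1)) atTop (𝓝 0) :=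
    tendsto_one_div_add_atTop_nhds_zero_nat
  simpa using this.const_add t

lemma tendsto_gridSucc_nhdsWithin (t : ℝ≥0) :
    Tendsto (fun n ↦ gridSucc n t) atTop (𝓝[Set.Ioi t ∩ rationals] t) :=
  tendsto_nhdsWithin_iff.2 ⟨tendsto_gridSucc t,
    Eventually.of_forall fun n ↦ ⟨lt_gridSucc n t, gridSucc_mem n t⟩⟩

instance neBot_nhdsWithin_rationals (t : ℝ≥0) : (𝓝[Set.Ioi t ∩ rationals] t).NeBot :=
  (tendsto_gridSucc_nhdsWithin t).neBot

/-- The path `g`, restricted to rational times in `[l, r]`, crosses the interval `(a, b)` upwards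
at least `k` times. -/
def HasUpcrossings (g : ℝ≥0 → ℝ) (a b : ℝ) : ℕ → ℝ≥0 → ℝ≥0 → Prop
  | 0, l, r => l ≤ r
  | k + 1, l, r => ∃ u s t, HasUpcrossings g a b k l u ∧ u < s ∧ s < t ∧ t ≤ r ∧
      s ∈ rationals ∧ t ∈ rationals ∧ g s < a ∧ b < g t

variable {g : ℝ≥0 → ℝ} {a b : ℝ}

/-- The recursive definition adds crossings on the right; near a point approached from the right,
each new crossing lies to the left of the earlier ones. -/
lemma HasUpcrossings.prepend {k : ℕ} {l s t u r : ℝ≥0} (h : HasUpcrossings g a b k u r)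
    (hls : l < s) (hst : s < t) (htu : t ≤ u) (hs : s ∈ rationals) (ht : t ∈ rationals)
    (hsa : g s < a) (htb : b < g t) : HasUpcrossings g a b (k + 1) l r := by
  induction k generalizing r with
  | zero => exact ⟨l, s, t, le_refl l, hls, hst, htu.trans h, hs, ht, hsa, htb⟩
  | succ k ih =>
    obtain ⟨v, s', t', hv, h'⟩ := h
    exact ⟨v, s', t', ih hv, h'⟩

lemma HasUpcrossings.mono_left {k : ℕ} {l l' r : ℝ≥0} (h : HasUpcrossings g a b k l r)
    (hl : l' ≤ l) : HasUpcrossings g a b k l' r := by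
  induction k generalizing r with
  | zero => exact hl.trans h
  | succ k ih =>
    obtain ⟨v, s', t', hv, h'⟩ := h
    exact ⟨v, s', t', ih hv, h'⟩

lemma exists_mem_of_frequently_nhdsWithin {S : Set ℝ≥0} {U : Set ℝ≥0} {p : ℝ≥0 → Prop} {t : ℝ≥0}
    (h : ∃ᶠ s in 𝓝[S] t, p s) (hU : U ∈ 𝓝 t) : ∃ s ∈ S, s ∈ U ∧ p s := by
  obtain ⟨s, ⟨hp, hs⟩, hsU⟩ :=
    ((h.and_eventually self_mem_nhdsWithin).and_eventually (mem_nhdsWithin_of_mem_nhds hU)).exists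
  exact ⟨s, hs, hsU, hp⟩

lemma exists_hasUpcrossings_of_frequently_left {t : ℝ≥0}
    (h₁ : ∃ᶠ s in 𝓝[Set.Iio t ∩ rationals] t, g s < a)
    (h₂ : ∃ᶠ s in 𝓝[Set.Iio t ∩ rationals] t, b < g s) (k : ℕ) :
    ∃ r < t, HasUpcrossings g a b k 0 r := by
  induction k with
  | zero =>
    obtain ⟨s, hs, -⟩ := exists_mem_of_frequently_nhdsWithin h₁ univ_mem
    exact ⟨s, hs.1, zero_le⟩
  | succ k ih =>
    obtain ⟨r, hr, hk⟩ := ih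
    obtain ⟨s, hs, hrs, hsa⟩ := exists_mem_of_frequently_nhdsWithin h₁ (Ioi_mem_nhds hr)
    obtain ⟨t', ht', hst, htb⟩ := exists_mem_of_frequently_nhdsWithin h₂ (Ioi_mem_nhds hs.1)
    exact ⟨t', ht'.1, r, s, t', hk, hrs, hst, le_rfl, hs.2, ht'.2, hsa, htb⟩

lemma exists_hasUpcrossings_of_frequently_right {t : ℝ≥0}
    (h₁ : ∃ᶠ s in 𝓝[Set.Ioi t ∩ rationals] t, g s < a)
    (h₂ : ∃ᶠ s in 𝓝[Set.Ioi t ∩ rationals] t, b < g s) (k : ℕ) :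
    ∃ l > t, HasUpcrossings g a b k l (t + 1) := by
  induction k with
  | zero => exact ⟨t + 1, by simp, le_refl (t + 1)⟩
  | succ k ih =>
    obtain ⟨l, hl, hk⟩ := ih
    obtain ⟨t', ht', htl, htb⟩ := exists_mem_of_frequently_nhdsWithin h₂ (Iio_mem_nhds hl)
    obtain ⟨s, hs, hst, hsa⟩ := exists_mem_of_frequently_nhdsWithin h₁ (Iio_mem_nhds ht'.1)
    obtain ⟨l', hl', hls⟩ := exists_between (Set.mem_Ioi.1 hs.1)
    exact ⟨l', hl', hk.prepend hls hst (le_of_lt htl) hs.2 ht'.2 hsa htb⟩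

/-- The restriction of `g` to the rationals has one-sided limits at every point. -/
def HasSidedLimits (g : ℝ≥0 → ℝ) : Prop :=
  ∀ t, (∃ l, Tendsto g (𝓝[Set.Iio t ∩ rationals] t) (𝓝 l)) ∧
    ∃ l, Tendsto g (𝓝[Set.Ioi t ∩ rationals] t) (𝓝 l)

/-- Without a one-sided limit, a bounded path would be frequently below some rational `a` and above
some rational `b > a` near the point. Alternating between the two produces arbitrarily many
crossings. -/
lemma hasSidedLimits_of_upcrossings {C : ℝ} (hC : ∀ t ∈ rationals, |g t| ≤ C)
    (h : ∀ a b : ℚ, a < b → ∃ k, ∀ r, ¬ HasUpcrossings g a b k 0 r) : HasSidedLimits g := by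
  have key (S : Set ℝ≥0) (t : ℝ≥0) (H : ∀ a b : ℝ, (∃ᶠ s in 𝓝[S ∩ rationals] t, g s < a) →
      (∃ᶠ s in 𝓝[S ∩ rationals] t, b < g s) → ∀ k, ∃ r, HasUpcrossings g a b k 0 r) :
      ∃ l, Tendsto g (𝓝[S ∩ rationals] t) (𝓝 l) := by
    refine tendsto_of_no_upcrossings Rat.denseRange_cast ?_ ?_ ?_
    · rintro _ ⟨a, rfl⟩ _ ⟨b, rfl⟩ hab ⟨h₁, h₂⟩
      obtain ⟨k, hk⟩ := h a b (by exact_mod_cast hab)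
      obtain ⟨r, hr⟩ := H _ _ h₁ h₂ k
      exact hk r hr
    · exact ⟨C, eventually_map.2 (eventually_nhdsWithin_of_forall
        fun s hs ↦ (abs_le.1 (hC s hs.2)).2)⟩
    · exact ⟨-C, eventually_map.2 (eventually_nhdsWithin_of_forall
        fun s hs ↦ (abs_le.1 (hC s hs.2)).1)⟩
  refine fun t ↦ ⟨key _ t fun a b h₁ h₂ k ↦ ?_, key _ t fun a b h₁ h₂ k ↦ ?_⟩
  · obtain ⟨r, -, hr⟩ := exists_hasUpcrossings_of_frequently_left h₁ h₂ k
    exact ⟨r, hr⟩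
  · obtain ⟨l, -, hl⟩ := exists_hasUpcrossings_of_frequently_right h₁ h₂ k
    exact ⟨_, hl.mono_left zero_le⟩

/-- The path of right limits of `g` along the rationals. -/
noncomputable def rightLimit (g : ℝ≥0 → ℝ) (t : ℝ≥0) : ℝ :=
  limUnder (𝓝[Set.Ioi t ∩ rationals] t) g

lemma HasSidedLimits.tendsto_rightLimit (hg : HasSidedLimits g) (t : ℝ≥0) :
    Tendsto g (𝓝[Set.Ioi t ∩ rationals] t) (𝓝 (rightLimit g t)) :=
  tendsto_nhds_limUnder (hg t).2

lemma HasSidedLimits.rightLimit_mem (hg : HasSidedLimits g) {t : ℝ≥0} {U : Set ℝ≥0} {K : Set ℝ}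
    (hU : U ∈ 𝓝[>] t) (hK : IsClosed K) (h : ∀ s ∈ U ∩ rationals, g s ∈ K) :
    rightLimit g t ∈ K := by
  refine hK.mem_of_tendsto (hg.tendsto_rightLimit t) ?_
  filter_upwards [nhdsWithin_mono t Set.inter_subset_left hU, self_mem_nhdsWithin] with s hsU hs
  exact h s ⟨hsU, hs.2⟩

/-- If `g` stays in a closed neighbourhood `K` of the limit at the rationals of an open set, so do
its right limits there. Closed neighbourhoods form a basis, so limits of `g` pass to `rightLimit g`.
-/
lemma HasSidedLimits.isCadlag_rightLimit (hg : HasSidedLimits g) : IsCadlag (rightLimit g) := by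
  have key (t : ℝ≥0) (l : ℝ) (S : Set ℝ≥0) (hS : IsOpen S)
      (h : Tendsto g (𝓝[S ∩ rationals] t) (𝓝 l)) : Tendsto (rightLimit g) (𝓝[S] t) (𝓝 l) := by
    rw [(closed_nhds_basis l).tendsto_right_iff]
    rintro K ⟨hKl, hK⟩
    obtain ⟨U, hU, htU, hUS⟩ := mem_nhdsWithin.1 (h hKl)
    refine mem_nhdsWithin.2 ⟨U, hU, htU, fun s hs ↦ ?_⟩
    exact hg.rightLimit_mem (mem_nhdsWithin_of_mem_nhds ((hU.inter hS).mem_nhds hs)) hK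
      fun q hq ↦ hUS ⟨hq.1.1, hq.1.2, hq.2⟩
  refine fun t ↦ ⟨?_, ?_⟩
  · rw [← continuousWithinAt_Ioi_iff_Ici]
    exact key t _ _ isOpen_Ioi (hg.tendsto_rightLimit t)
  · obtain ⟨l, hl⟩ := (hg t).1
    exact ⟨l, key t l _ isOpen_Iio hl⟩

/-! ### Upcrossings of martingales -/

/-- The grids of mesh `1 / n!` are nested and exhaust the rationals, so any finite set of rational
times eventually lies in a single grid. -/
lemma eventually_exists_eq_div_factorial {s : ℝ≥0} (hs : s ∈ rationals) :
    ∀ᶠ n : ℕ in atTop, ∃ i : ℕ, s = i / (n.factorial : ℝ≥0) := by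
  obtain ⟨k, d, rfl⟩ := hs
  filter_upwards [eventually_ge_atTop (d + 1)] with n hn
  obtain ⟨c, hc⟩ := Nat.dvd_factorial (Nat.succ_pos d) hn
  refine ⟨k * c, ?_⟩
  have hc0 : (c : ℝ≥0) ≠ 0 := by
    rintro h
    rw [Nat.cast_eq_zero] at h
    exact n.factorial_ne_zero (by rw [hc, h, mul_zero])
  rw [hc]
  push_cast
  rw [mul_div_mul_right _ _ hc0]

lemma HasUpcrossings.eventually_le_upcrossingsBefore {f : ℝ≥0 → Ω → ℝ} {ω : Ω} (hab : a < b)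
    {k : ℕ} {l r : ℝ≥0} (h : HasUpcrossings (fun t ↦ f t ω) a b k l r) :
    ∀ᶠ n : ℕ in atTop, ∀ N : ℕ, r < N / (n.factorial : ℝ≥0) →
      k ≤ upcrossingsBefore a b (fun (i : ℕ) ↦ f (i / (n.factorial : ℝ≥0))) N ω := by
  induction k generalizing r with
  | zero => simp
  | succ k ih =>
    obtain ⟨u, s, t, hu, hus, hst, htr, hs, ht, hsa, htb⟩ := h
    filter_upwards [ih hu, eventually_exists_eq_div_factorial hs,
      eventually_exists_eq_div_factorial ht] with n hn ⟨i, hi⟩ ⟨j, hj⟩ N hN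
    have hpos : (0 : ℝ≥0) < n.factorial := by exact_mod_cast n.factorial_pos
    subst hi hj
    have hij : i ≤ j := by
      rw [div_lt_div_iff_of_pos_right hpos] at hst
      exact_mod_cast hst.le
    have hjN : j + 1 ≤ N := by
      have := htr.trans_lt hN
      rw [div_lt_div_iff_of_pos_right hpos] at this
      exact_mod_cast this
    exact ((hn i hus).trans_lt (upcrossingsBefore_lt_of_exists_upcrossing
      (f := fun (i : ℕ) ↦ f (i / (n.factorial : ℝ≥0))) hab le_rfl hsa hij htb)).trans_le
      (upcrossingsBefore_mono hab hjN ω)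

/-- The filtration `𝓕` at the times `i / d`. -/
noncomputable def gridFiltration (𝓕 : Filtration ℝ≥0 m) (d : ℝ≥0) : Filtration ℕ m where
  seq i := 𝓕 (i / d)
  mono' i j hij := 𝓕.mono (by gcongr)
  le' i := 𝓕.le _

/-- On each factorial grid Doob's inequality bounds the expected number of upcrossings by `(C + |a|)
/ (b - a)`, uniformly in the grid. By Fatou the liminf of these numbers is almost surely finite, and
it dominates any number of rational crossings. -/
lemma ae_exists_not_hasUpcrossings {P : Measure Ω} [IsProbabilityMeasure P]
    {𝓕 : Filtration ℝ≥0 m} {N : ℝ≥0 → Ω → ℝ} (hN : Martingale N 𝓕 P) {C : ℝ}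
    (hC : ∀ t, ∀ᵐ ω ∂P, |N t ω| ≤ C) (hab : a < b) :
    ∀ᵐ ω ∂P, ∃ k, ∀ r, ¬ HasUpcrossings (fun t ↦ N t ω) a b k 0 r := by
  let f (n i : ℕ) : Ω → ℝ := N (i / (n.factorial : ℝ≥0))
  have hf (n : ℕ) : Martingale (f n) (gridFiltration 𝓕 n.factorial) P :=
    ⟨fun i ↦ hN.1 _, fun i j hij ↦ hN.2 _ _ (by gcongr)⟩
  have hbound (n : ℕ) :
      ENNReal.ofReal (b - a) * ∫⁻ ω, upcrossings a b (f n) ω ∂P ≤ ENNReal.ofReal (C + |a|) := by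
    refine ((hf n).submartingale.mul_lintegral_upcrossings_le_lintegral_pos_part a b).trans ?_
    refine iSup_le fun i ↦ ?_
    calc ∫⁻ ω, ENNReal.ofReal ((f n i ω - a)⁺) ∂P
        ≤ ∫⁻ ω, ENNReal.ofReal (C + |a|) ∂P := by
          refine lintegral_mono_ae ?_
          filter_upwards [hC (i / (n.factorial : ℝ≥0))] with ω hω
          refine ENNReal.ofReal_le_ofReal (sup_le ?_ ?_)
          · have := (abs_le.1 hω).2
            have := neg_abs_le a
            linarith
          · exact add_nonneg ((abs_nonneg _).trans hω) (abs_nonneg a)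
      _ = ENNReal.ofReal (C + |a|) := by simp
  have hmeas (n : ℕ) : Measurable (upcrossings a b (f n)) :=
    (hf n).1.measurable_upcrossings hab
  have hpos : ENNReal.ofReal (b - a) ≠ 0 := by simpa using hab
  have hfatou : ∫⁻ ω, liminf (fun n ↦ upcrossings a b (f n) ω) atTop ∂P < ∞ := by
    refine (lintegral_liminf_le hmeas).trans_lt ?_
    refine lt_of_le_of_lt (b := ENNReal.ofReal (C + |a|) / ENNReal.ofReal (b - a)) ?_
      (ENNReal.div_lt_top ENNReal.ofReal_ne_top hpos)
    refine liminf_le_of_le (by isBoundedDefault) fun c hc ↦ ?_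
    obtain ⟨n, hn⟩ := hc.exists
    refine hn.trans ?_
    rw [ENNReal.le_div_iff_mul_le (Or.inl hpos) (Or.inl ENNReal.ofReal_ne_top), mul_comm]
    exact hbound n
  filter_upwards [ae_lt_top (Measurable.liminf hmeas) hfatou.ne] with ω hω
  obtain ⟨k, hk⟩ := ENNReal.exists_nat_gt hω.ne
  refine ⟨k, fun r hr ↦ hk.not_ge ?_⟩
  refine le_liminf_of_le (by isBoundedDefault) ?_
  filter_upwards [hr.eventually_le_upcrossingsBefore hab] with n hn
  have hpos : (0 : ℝ≥0) < n.factorial := by exact_mod_cast n.factorial_pos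
  obtain ⟨M, hM⟩ := exists_nat_gt (r * n.factorial)
  refine le_trans ?_ (le_iSup _ M)
  exact_mod_cast hn M ((lt_div_iff₀ hpos).2 hM)

/-- A bounded martingale almost surely has one-sided limits along the rationals. -/
theorem ae_hasSidedLimits {P : Measure Ω} [IsProbabilityMeasure P]
    {𝓕 : Filtration ℝ≥0 m} {N : ℝ≥0 → Ω → ℝ} (hN : Martingale N 𝓕 P) {C : ℝ}
    (hC : ∀ t, ∀ᵐ ω ∂P, |N t ω| ≤ C) : ∀ᵐ ω ∂P, HasSidedLimits fun t ↦ N t ω := by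
  have h₁ : ∀ᵐ ω ∂P, ∀ t ∈ rationals, |N t ω| ≤ C :=
    (ae_ball_iff countable_rationals).2 fun t _ ↦ hC t
  have h₂ : ∀ᵐ ω ∂P, ∀ a b : ℚ, a < b →
      ∃ k, ∀ r, ¬ HasUpcrossings (fun t ↦ N t ω) a b k 0 r := by
    refine ae_all_iff.2 fun a ↦ ae_all_iff.2 fun b ↦ ?_
    by_cases hab : a < b
    · filter_upwards [ae_exists_not_hasUpcrossings hN hC (Rat.cast_lt.2 hab)] with ω hω _
      exact hω
    · simp [hab]
  filter_upwards [h₁, h₂] with ω hω₁ hω₂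
  exact hasSidedLimits_of_upcrossings hω₁ hω₂

/-! ### Measurability of optional processes -/

section Measurability

/-- The rounded time takes countably many values, so measurability of `Z` at each grid time
suffices. -/
lemma measurable_comp_gridSucc {α β : Type*} [MeasurableSpace α] [MeasurableSpace β]
    {Z : ℝ≥0 → α → β} (n : ℕ) (hZ : ∀ k : ℕ, Measurable (Z (k / (n + 1)))) {τ : α → ℝ≥0}
    (hτ : Measurable τ) : Measurable fun x ↦ Z (gridSucc n (τ x)) x := by
  have h₁ : Measurable fun q : ℕ × α ↦ Z ((q.1 + 1 : ℕ) / (n + 1)) q.2 := by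
    refine measurable_from_prod_countable_right fun k ↦ ?_
    dsimp only
    exact hZ (k + 1)
  have h₂ : Measurable fun x ↦ ⌊((n : ℝ≥0) + 1) * τ x⌋₊ :=
    Nat.measurable_floor.comp (hτ.const_mul _)
  have h₃ := h₁.comp (h₂.prodMk measurable_id)
  simp only [Function.comp_def, id] at h₃
  simp only [gridSucc]
  exact h₃

variable {𝓕 : Filtration ℝ≥0 m}

lemma isProgressive_of_rightContinuous {X : ℝ≥0 → Ω → ℝ} (hX : Adapted 𝓕 X)
    (hr : ∀ ω t, ContinuousWithinAt (fun s ↦ X s ω) (Set.Ici t) t) : IsProgressive 𝓕 X := by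
  intro t
  let _ : MeasurableSpace Ω := 𝓕 t
  have hlim (p : Set.Iic t × Ω) :
      Tendsto (fun n ↦ X (min t (gridSucc n p.1)) p.2) atTop (𝓝 (X p.1 p.2)) := by
    refine (hr p.2 p.1).tendsto.comp (tendsto_nhdsWithin_iff.2 ⟨?_, ?_⟩)
    -- Capping at `t` keeps the approximants `𝓕 t`-measurable; they still approach `p.1` from the
    -- right because `p.1 ≤ t`.
    · have h := (tendsto_const_nhds (x := t)).min (tendsto_gridSucc (p.1 : ℝ≥0))
      rwa [min_eq_right (show (p.1 : ℝ≥0) ≤ t from p.1.2)] at h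
    · exact Eventually.of_forall fun n ↦ le_min p.1.2 (lt_gridSucc _ _).le
  refine measurable_of_tendsto_metrizable (fun n ↦ ?_) (tendsto_pi_nhds.2 hlim)
  exact measurable_comp_gridSucc (Z := fun u (p : Set.Iic t × Ω) ↦ X (min t u) p.2) n
    (fun k ↦ (hX.measurable_le (min_le_left t _)).comp measurable_snd)
    (measurable_subtype_coe.comp measurable_fst)

/-- It suffices to test the generators of the optional σ-algebra, and for these the claim is
progressive measurability. -/
lemma measurable_inclusion_optional (t : ℝ≥0) :
    Measurable[Subtype.instMeasurableSpace.prod (𝓕 t), optional 𝓕]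
      fun p : Set.Iic t × Ω ↦ ((p.1 : ℝ≥0), p.2) := by
  rw [measurable_iff_comap_le]
  simp only [optional, MeasurableSpace.comap_iSup, MeasurableSpace.comap_comp]
  refine iSup₂_le fun X hX ↦ ?_
  exact (isProgressive_of_rightContinuous hX.1 (fun ω s ↦ (hX.2 ω s).1) t).comap_le

lemma isProgressive_of_optional {β : Type*} [MeasurableSpace β] {Y : ℝ≥0 → Ω → β}
    (hY : Measurable[optional 𝓕] (Function.uncurry Y)) : IsProgressive 𝓕 Y :=
  fun t ↦ hY.comp (measurable_inclusion_optional t)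

lemma optional_le_prod : optional 𝓕 ≤ Prod.instMeasurableSpace := by
  refine iSup₂_le fun X hX ↦ Measurable.comap_le ?_
  -- For the constant filtration `m`, progressive measurability is joint measurability on each `[0,
  -- n] × Ω`.
  have h : IsProgressive (Filtration.const ℝ≥0 m le_rfl) X :=
    isProgressive_of_rightContinuous (fun t ↦ (hX.1 t).mono (𝓕.le t) le_rfl)
      fun ω s ↦ (hX.2 ω s).1
  have hlim (p : ℝ≥0 × Ω) :
      Tendsto (fun n : ℕ ↦ X (min p.1 n) p.2) atTop (𝓝 (Function.uncurry X p)) := by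
    refine tendsto_const_nhds.congr' ?_
    obtain ⟨k, hk⟩ := exists_nat_ge p.1
    filter_upwards [eventually_ge_atTop k] with n hn
    rw [min_eq_left (hk.trans (by exact_mod_cast hn))]
    rfl
  refine measurable_of_tendsto_metrizable (fun n ↦ ?_) (tendsto_pi_nhds.2 hlim)
  have h₂ : Measurable fun p : ℝ≥0 × Ω ↦
      ((⟨min p.1 n, Set.mem_Iic.2 (min_le_right _ _)⟩ : Set.Iic (n : ℝ≥0)), p.2) :=
    Measurable.prodMk (Measurable.subtype_mk (by fun_prop)) measurable_snd
  exact (h n).comp h₂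

lemma IsOptionalProjection.measurable_uncurry {P : Measure Ω}
    {X Y : ℝ≥0 → Ω → ℝ≥0∞}
    (h : IsOptionalProjection 𝓕 P X Y) : Measurable (Function.uncurry Y) :=
  h.optional.mono optional_le_prod le_rfl

lemma measurable_uncurry_optional {X : ℝ≥0 → Ω → ℝ} (hX : Adapted 𝓕 X)
    (hc : ∀ ω, IsCadlag fun t ↦ X t ω) : Measurable[optional 𝓕] (Function.uncurry X) :=
  measurable_iff_comap_le.2
    (le_iSup₂_of_le (f := fun (X : ℝ≥0 → Ω → ℝ) (_ : Adapted 𝓕 X ∧ ∀ ω, IsCadlag fun t ↦ X t ω) ↦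
      MeasurableSpace.comap (Function.uncurry X) inferInstance) X ⟨hX, hc⟩ le_rfl)

lemma measurableSet_lt_top {T : Ω → WithTop ℝ≥0} (hT : IsStoppingTime 𝓕 T) :
    MeasurableSet[hT.measurableSpace] {ω | T ω < ⊤} :=
  hT.measurable measurableSet_Iio

lemma measurable_valueAt {Y : ℝ≥0 → Ω → ℝ≥0∞}
    (hY : Measurable[optional 𝓕] (Function.uncurry Y)) {T : Ω → WithTop ℝ≥0}
    (hT : IsStoppingTime 𝓕 T) : Measurable[hT.measurableSpace] (valueAt Y T) :=
  (measurable_stoppedValue (isProgressive_of_optional hY).isStronglyProgressive hT).indicator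
    (measurableSet_lt_top hT)

/-- Testing only on events inside `{T < ∞}` makes the junk value of `stoppedValue` at `T = ∞`
irrelevant. -/
lemma isOptionalProjection_of_setLIntegral {P : Measure Ω} [IsProbabilityMeasure P]
    {X Y : ℝ≥0 → Ω → ℝ≥0∞} (hY : Measurable[optional 𝓕] (Function.uncurry Y))
    (h : ∀ (T : Ω → WithTop ℝ≥0) (hT : IsStoppingTime 𝓕 T) (A : Set Ω),
      MeasurableSet[hT.measurableSpace] A → A ⊆ {ω | T ω < ⊤} →
      ∫⁻ ω in A, stoppedValue Y T ω ∂P = ∫⁻ ω in A, stoppedValue X T ω ∂P) :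
    IsOptionalProjection 𝓕 P X Y := by
  refine ⟨hY, fun T hT ↦ ae_eq_condLExp hT.measurableSpace_le P _ (measurable_valueAt hY hT)
    fun A hA ↦ ?_⟩
  have htop : MeasurableSet {ω | T ω < ⊤} := hT.measurableSpace_le _ (measurableSet_lt_top hT)
  rw [valueAt, valueAt, lintegral_indicator htop, lintegral_indicator htop,
    Measure.restrict_restrict htop]
  exact h T hT _ ((measurableSet_lt_top hT).inter hA) Set.inter_subset_left

lemma IsOptionalProjection.setLIntegral_eq {P : Measure Ω} [IsProbabilityMeasure P]
    {X Y : ℝ≥0 → Ω → ℝ≥0∞} (h : IsOptionalProjection 𝓕 P X Y) {T : Ω → WithTop ℝ≥0}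
    (hT : IsStoppingTime 𝓕 T) {A : Set Ω} (hA : MeasurableSet[hT.measurableSpace] A)
    (hAT : A ⊆ {ω | T ω < ⊤}) :
    ∫⁻ ω in A, stoppedValue Y T ω ∂P = ∫⁻ ω in A, stoppedValue X T ω ∂P := by
  have hA' : MeasurableSet A := hT.measurableSpace_le _ hA
  have heq (Z : ℝ≥0 → Ω → ℝ≥0∞) :
      ∫⁻ ω in A, stoppedValue Z T ω ∂P = ∫⁻ ω in A, valueAt Z T ω ∂P :=
    setLIntegral_congr_fun hA' fun ω hω ↦ (Set.indicator_of_mem (hAT hω) _).symm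
  rw [heq, heq, ← setLIntegral_condLExp hT.measurableSpace_le P (valueAt X T) hA]
  exact setLIntegral_congr_fun_ae hA' ((h.condExp T hT).mono fun ω hω _ ↦ hω)

end Measurability

/-! ### Existence of optional projections -/

section Existence

variable {𝓕 : Filtration ℝ≥0 m} {P : Measure Ω} [IsProbabilityMeasure P]

/-- A tail of the sequence is `𝓕 s`-measurable for each `s > t`, so the limit is measurable for
their intersection, which lies in `𝓕 t`. -/
lemma measurable_of_tendsto_of_isRightContinuous [𝓕.IsRightContinuous] {t : ℝ≥0}
    {f : ℕ → Ω → ℝ} {g : Ω → ℝ} {u : ℕ → ℝ≥0} (hu : Tendsto u atTop (𝓝 t))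
    (hf : ∀ n, Measurable[𝓕 (u n)] (f n)) (hfg : ∀ ω, Tendsto (fun n ↦ f n ω) atTop (𝓝 (g ω))) :
    Measurable[𝓕 t] g := by
  have h (s : ℝ≥0) (hs : t < s) : Measurable[𝓕 s] g := by
    obtain ⟨n₀, hn₀⟩ := eventually_atTop.1 (hu.eventually_le_const hs)
    let _ : MeasurableSpace Ω := 𝓕 s
    exact measurable_of_tendsto_metrizable
      (fun n ↦ (hf (n + n₀)).mono (𝓕.mono (hn₀ _ (Nat.le_add_left _ _))) le_rfl)
      (tendsto_pi_nhds.2 fun ω ↦ (tendsto_add_atTop_iff_nat n₀).2 (hfg ω))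
  intro S hS
  refine Filtration.IsRightContinuous.measurableSet ?_
  rw [Filtration.rightCont_eq]
  simp only [MeasurableSpace.measurableSet_iInf]
  exact fun s hs ↦ h s hs hS

lemma setLIntegral_condExp_indicator {B A : Set Ω} (hB : MeasurableSet B) {t : ℝ≥0}
    (hA : MeasurableSet[𝓕 t] A) :
    ∫⁻ ω in A, ENNReal.ofReal (P[B.indicator (1 : Ω → ℝ) | 𝓕 t] ω) ∂P =
      ∫⁻ ω in A, B.indicator 1 ω ∂P := by
  have h := condLExp_ofReal (𝓕 t) (μ := P) (f := B.indicator (1 : Ω → ℝ))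
    ((integrable_const 1).indicator hB)
    (Eventually.of_forall fun ω ↦ Set.indicator_nonneg (fun _ _ ↦ zero_le_one) ω)
  have h' : (fun ω ↦ ENNReal.ofReal (B.indicator (1 : Ω → ℝ) ω)) = B.indicator 1 := by
    ext ω
    by_cases hω : ω ∈ B <;> simp [hω]
  rw [h'] at h
  rw [← setLIntegral_condLExp (𝓕.le t) P (B.indicator 1) hA]
  exact setLIntegral_congr_fun_ae (𝓕.le t _ hA) (h.mono fun ω hω _ ↦ hω.symm)

/-- This is optional stopping at a countably valued time: `A` is cut into the slices where the
rounded time is a constant `u`, and the conditional expectation given `𝓕 u` is integrated over each.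
-/
lemma setLIntegral_gridSucc {B A : Set Ω} (hB : MeasurableSet B) {T : Ω → WithTop ℝ≥0}
    (hT : IsStoppingTime 𝓕 T) (hA : MeasurableSet[hT.measurableSpace] A)
    (hAT : A ⊆ {ω | T ω < ⊤}) (n : ℕ) :
    ∫⁻ ω in A, ENNReal.ofReal
        (P[B.indicator (1 : Ω → ℝ) | 𝓕 (gridSucc n (T ω).untopA)] ω) ∂P =
      ∫⁻ ω in A, B.indicator 1 ω ∂P := by
  let κ (ω : Ω) : ℕ := ⌊((n : ℝ≥0) + 1) * (T ω).untopA⌋₊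
  have hκ : Measurable[hT.measurableSpace] κ :=
    Nat.measurable_floor.comp (hT.measurable.untopA.const_mul _)
  let Ak (k : ℕ) : Set Ω := A ∩ κ ⁻¹' {k}
  have hAk (k : ℕ) : MeasurableSet[hT.measurableSpace] (Ak k) :=
    hA.inter (hκ (measurableSet_singleton k))
  have hunion : A = ⋃ k, Ak k := by
    ext ω
    simp [Ak]
  have hdisj : Pairwise (Function.onFun Disjoint Ak) := by
    intro i j hij
    refine Set.disjoint_left.2 fun ω hi hj ↦ hij ?_
    exact (Set.mem_singleton_iff.1 hi.2).symm.trans (Set.mem_singleton_iff.1 hj.2)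
  have hsum (h : Ω → ℝ≥0∞) : ∫⁻ ω in A, h ω ∂P = ∑' k, ∫⁻ ω in Ak k, h ω ∂P := by
    rw [hunion, lintegral_iUnion (fun k ↦ hT.measurableSpace_le _ (hAk k)) hdisj]
  rw [hsum, hsum]
  congr 1 with k
  set u : ℝ≥0 := (k + 1 : ℕ) / (n + 1) with hu
  have hgrid : ∀ ω ∈ Ak k, gridSucc n (T ω).untopA = u := by
    rintro ω ⟨-, hω⟩
    rw [gridSucc, show ⌊((n : ℝ≥0) + 1) * (T ω).untopA⌋₊ = k from hω]
  -- Rounding up strictly gives `T < u` on the slice, so intersecting it with `{T ≤ u}` changes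
  -- nothing.
  have hAu : MeasurableSet[𝓕 u] (Ak k) := by
    have h := ((hT.measurableSet _).1 (hAk k)).2 u
    rwa [Set.inter_eq_left.2] at h
    intro ω hω
    have hlt := lt_gridSucc n (T ω).untopA
    rw [hgrid ω hω] at hlt
    have hne : T ω ≠ ⊤ := (hAT hω.1).ne
    change T ω ≤ u
    rw [← WithTop.coe_untop _ hne, ← WithTop.untopA_eq_untop hne]
    exact_mod_cast hlt.le
  rw [← setLIntegral_condExp_indicator hB hAu]
  refine setLIntegral_congr_fun (𝓕.le u _ hAu) fun ω hω ↦ ?_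
  simp only [hgrid ω hω]

/-- The càdlàg martingale closed by the indicator of an event, with optional stopping. -/
theorem exists_cadlag_projection (h𝓕 : UsualHypotheses 𝓕 P) {B : Set Ω} (hB : MeasurableSet B) :
    ∃ M : ℝ≥0 → Ω → ℝ, Adapted 𝓕 M ∧ (∀ ω, IsCadlag fun t ↦ M t ω) ∧
      ∀ (T : Ω → WithTop ℝ≥0) (hT : IsStoppingTime 𝓕 T) (A : Set Ω),
        MeasurableSet[hT.measurableSpace] A → A ⊆ {ω | T ω < ⊤} →
        ∫⁻ ω in A, ENNReal.ofReal (M (T ω).untopA ω) ∂P = ∫⁻ ω in A, B.indicator 1 ω ∂P := by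
  have := h𝓕.rightContinuous
  let N (t : ℝ≥0) : Ω → ℝ := P[B.indicator (1 : Ω → ℝ) | 𝓕 t]
  have hint : Integrable (B.indicator (1 : Ω → ℝ)) P := (integrable_const 1).indicator hB
  have hN : Martingale N 𝓕 P := martingale_condExp _ 𝓕 P
  have hN0 (t : ℝ≥0) : ∀ᵐ ω ∂P, 0 ≤ N t ω :=
    condExp_nonneg (Eventually.of_forall fun ω ↦ Set.indicator_nonneg (fun _ _ ↦ zero_le_one) ω)
  have hN1 (t : ℝ≥0) : ∀ᵐ ω ∂P, N t ω ≤ 1 := by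
    have h := condExp_mono (m := 𝓕 t) hint (integrable_const (1 : ℝ))
      (Eventually.of_forall fun ω ↦ Set.indicator_le_self' (fun _ _ ↦ zero_le_one) ω)
    rw [condExp_const (𝓕.le t)] at h
    exact h
  have hgood : ∀ᵐ ω ∂P, HasSidedLimits fun t ↦ N t ω :=
    ae_hasSidedLimits hN (C := 1) fun t ↦ by
      filter_upwards [hN0 t, hN1 t] with ω h₀ h₁
      exact abs_le.2 ⟨by linarith, h₁⟩
  let G : Set Ω := {ω | HasSidedLimits fun t ↦ N t ω}
  -- The complement of `G` is null, so completeness puts `G` in `𝓕 0`; killing the bad paths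
  -- preserves adaptedness.
  have hG (t : ℝ≥0) : MeasurableSet[𝓕 t] G :=
    𝓕.mono zero_le _ (MeasurableSet.of_compl (h𝓕.complete _ hgood))
  let M (t : ℝ≥0) : Ω → ℝ := G.indicator fun ω ↦ rightLimit (fun t ↦ N t ω) t
  refine ⟨M, fun t ↦ ?_, fun ω ↦ ?_, fun T hT A hA hAT ↦ ?_⟩
  · refine measurable_of_tendsto_of_isRightContinuous (tendsto_gridSucc t)
      (fun n ↦ (hN.1 (gridSucc n t)).measurable.indicator (hG _)) fun ω ↦ ?_
    by_cases hω : ω ∈ G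
    · simpa [M, hω, Function.comp_def] using (HasSidedLimits.tendsto_rightLimit hω t).comp
        (tendsto_gridSucc_nhdsWithin t)
    · simp [M, hω]
  · by_cases hω : ω ∈ G
    · simpa [M, hω] using HasSidedLimits.isCadlag_rightLimit hω
    · have h : (fun t ↦ M t ω) = fun _ ↦ 0 := by simp [M, hω]
      rw [h]
      exact fun t ↦ ⟨continuousWithinAt_const, 0, tendsto_const_nhds⟩
  · have hmeas (n : ℕ) : Measurable fun ω ↦ N (gridSucc n (T ω).untopA) ω :=
      measurable_comp_gridSucc n (fun k ↦ (hN.1 _).measurable.mono (𝓕.le _) le_rfl)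
        hT.measurable'.untopA
    -- The sampled values converge to `M_T` and are bounded by `1` off one null set, that of the
    -- countably many rational times. Each integral in the sequence already equals `P(A ∩ B)`.
    have hlim : Tendsto (fun n ↦ ∫⁻ ω in A, ENNReal.ofReal (N (gridSucc n (T ω).untopA) ω) ∂P)
        atTop (𝓝 (∫⁻ ω in A, ENNReal.ofReal (M (T ω).untopA ω) ∂P)) := by
      refine tendsto_lintegral_of_dominated_convergence (fun _ ↦ 1)
        (fun n ↦ (hmeas n).ennreal_ofReal) (fun n ↦ ae_restrict_of_ae ?_) (by simp)
        (ae_restrict_of_ae ?_)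
      · have h₁ : ∀ᵐ ω ∂P, ∀ t ∈ rationals, N t ω ≤ 1 :=
          (ae_ball_iff countable_rationals).2 fun t _ ↦ hN1 t
        filter_upwards [h₁] with ω hω
        exact ENNReal.ofReal_le_one.2 (hω _ (gridSucc_mem _ _))
      · filter_upwards [hgood] with ω hω
        have hωG : ω ∈ G := hω
        refine (ENNReal.continuous_ofReal.tendsto _).comp ?_
        simpa [M, hωG, Function.comp_def] using (hω.tendsto_rightLimit _).comp (tendsto_gridSucc_nhdsWithin _)
    exact tendsto_nhds_unique hlim
      (tendsto_const_nhds.congr fun n ↦ (setLIntegral_gridSucc hB hT hA hAT n).symm)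

/-! ### From indicators of rectangles to all nonnegative measurable processes -/

lemma isCadlag_indicator_Ici (a : ℝ≥0) : IsCadlag ((Set.Ici a).indicator 1) := by
  intro t
  rcases lt_or_ge t a with h | h
  · have hev : (Set.Ici a).indicator (1 : ℝ≥0 → ℝ) =ᶠ[𝓝 t] fun _ ↦ 0 := by
      filter_upwards [Iio_mem_nhds h] with s hs
      exact Set.indicator_of_notMem (not_le.2 hs) _
    exact ⟨(continuousAt_const.congr hev.symm).continuousWithinAt, 0,
      (tendsto_const_nhds.congr' hev.symm).mono_left nhdsWithin_le_nhds⟩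
  · refine ⟨?_, ?_⟩
    · refine continuousWithinAt_const.congr (f := fun _ ↦ (1 : ℝ)) (fun s hs ↦ ?_) ?_
      · exact Set.indicator_of_mem (Set.mem_Ici.2 (h.trans hs)) _
      · exact Set.indicator_of_mem (Set.mem_Ici.2 h) _
    · rcases h.eq_or_lt with rfl | h
      · refine ⟨0, tendsto_const_nhds.congr' ?_⟩
        filter_upwards [self_mem_nhdsWithin] with s hs
        exact (Set.indicator_of_notMem (not_le.2 hs) _).symm
      · refine ⟨1, tendsto_const_nhds.congr' ?_⟩
        filter_upwards [mem_nhdsWithin_of_mem_nhds (Ioi_mem_nhds h)] with s hs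
        rw [Set.indicator_of_mem (Set.mem_Ici.2 (Set.mem_Ioi.1 hs).le), Pi.one_apply]

lemma measurable_stoppedValue_of_uncurry {X : ℝ≥0 → Ω → ℝ≥0∞}
    (hX : Measurable (Function.uncurry X)) {T : Ω → WithTop ℝ≥0} (hT : IsStoppingTime 𝓕 T) :
    Measurable (stoppedValue X T) :=
  hX.comp (hT.measurable'.untopA.prodMk measurable_id)

lemma exists_isOptionalProjection_Ici_prod (h𝓕 : UsualHypotheses 𝓕 P) (a : ℝ≥0) {B : Set Ω}
    (hB : MeasurableSet B) :
    ∃ Y, IsOptionalProjection 𝓕 P (fun t ω ↦ (Set.Ici a ×ˢ B).indicator 1 (t, ω)) Y := by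
  obtain ⟨M, hM, hMc, hMT⟩ := exists_cadlag_projection h𝓕 hB
  let I (t : ℝ≥0) (_ : Ω) : ℝ := (Set.Ici a).indicator 1 t
  refine ⟨fun t ω ↦ ENNReal.ofReal (I t ω) * ENNReal.ofReal (M t ω),
    isOptionalProjection_of_setLIntegral ?_ fun T hT A hA hAT ↦ ?_⟩
  · have hI : Measurable[optional 𝓕] (Function.uncurry I) :=
      measurable_uncurry_optional (fun t ↦ measurable_const) fun ω ↦ isCadlag_indicator_Ici a
    have hM' := measurable_uncurry_optional hM hMc
    let _ : MeasurableSpace (ℝ≥0 × Ω) := StoppingCompensator.optional 𝓕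
    exact hI.ennreal_ofReal.mul hM'.ennreal_ofReal
  · let S : Set Ω := {ω | a ≤ (T ω).untopA}
    have hS : MeasurableSet[hT.measurableSpace] S := hT.measurable.untopA measurableSet_Ici
    have hS' := hT.measurableSpace_le _ hS
    have h₁ : (stoppedValue (fun t ω ↦ ENNReal.ofReal (I t ω) * ENNReal.ofReal (M t ω)) T) =
        S.indicator fun ω ↦ ENNReal.ofReal (M (T ω).untopA ω) := by
      ext ω
      by_cases hω : a ≤ (T ω).untopA <;> simp [stoppedValue, I, S, hω]
    have h₂ : (stoppedValue (fun t ω ↦ (Set.Ici a ×ˢ B).indicator (1 : ℝ≥0 × Ω → ℝ≥0∞) (t, ω)) T) =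
        S.indicator (B.indicator 1) := by
      ext ω
      by_cases hω : a ≤ (T ω).untopA <;> by_cases hωB : ω ∈ B <;>
        simp [stoppedValue, S, hω, hωB]
    rw [h₁, h₂, lintegral_indicator hS', lintegral_indicator hS', Measure.restrict_restrict hS']
    exact hMT T hT _ (hS.inter hA) (Set.inter_subset_right.trans hAT)

lemma IsOptionalProjection.tsum {X Y : ℕ → ℝ≥0 → Ω → ℝ≥0∞}
    (hX : ∀ n, Measurable (Function.uncurry (X n)))
    (h : ∀ n, IsOptionalProjection 𝓕 P (X n) (Y n)) :
    IsOptionalProjection 𝓕 P (fun t ω ↦ ∑' n, X n t ω) (fun t ω ↦ ∑' n, Y n t ω) := by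
  refine isOptionalProjection_of_setLIntegral ?_ fun T hT A hA hAT ↦ ?_
  · have hY (n : ℕ) := (h n).optional
    let _ : MeasurableSpace (ℝ≥0 × Ω) := StoppingCompensator.optional 𝓕
    exact Measurable.tsum hY
  · calc ∫⁻ ω in A, ∑' n, stoppedValue (Y n) T ω ∂P
        = ∑' n, ∫⁻ ω in A, stoppedValue (Y n) T ω ∂P := lintegral_tsum fun n ↦
          (measurable_stoppedValue_of_uncurry (h n).measurable_uncurry hT).aemeasurable
      _ = ∑' n, ∫⁻ ω in A, stoppedValue (X n) T ω ∂P := by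
          congr 1 with n
          exact (h n).setLIntegral_eq hT hA hAT
      _ = ∫⁻ ω in A, ∑' n, stoppedValue (X n) T ω ∂P := (lintegral_tsum fun n ↦
          (measurable_stoppedValue_of_uncurry (hX n) hT).aemeasurable).symm

lemma IsOptionalProjection.add {X X' Y Y' : ℝ≥0 → Ω → ℝ≥0∞}
    (hX : Measurable (Function.uncurry X))
    (h : IsOptionalProjection 𝓕 P X Y) (h' : IsOptionalProjection 𝓕 P X' Y') :
    IsOptionalProjection 𝓕 P (fun t ω ↦ X t ω + X' t ω) (fun t ω ↦ Y t ω + Y' t ω) := by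
  refine isOptionalProjection_of_setLIntegral ?_ fun T hT A hA hAT ↦ ?_
  · have h₁ := h.optional
    have h₂ := h'.optional
    let _ : MeasurableSpace (ℝ≥0 × Ω) := StoppingCompensator.optional 𝓕
    exact h₁.add h₂
  · change ∫⁻ ω in A, stoppedValue Y T ω + stoppedValue Y' T ω ∂P =
      ∫⁻ ω in A, stoppedValue X T ω + stoppedValue X' T ω ∂P
    rw [lintegral_add_left (measurable_stoppedValue_of_uncurry h.measurable_uncurry hT),
      lintegral_add_left (measurable_stoppedValue_of_uncurry hX hT),
      h.setLIntegral_eq hT hA hAT, h'.setLIntegral_eq hT hA hAT]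

lemma IsOptionalProjection.const_mul {X Y : ℝ≥0 → Ω → ℝ≥0∞}
    (hX : Measurable (Function.uncurry X)) (h : IsOptionalProjection 𝓕 P X Y) (c : ℝ≥0∞) :
    IsOptionalProjection 𝓕 P (fun t ω ↦ c * X t ω) (fun t ω ↦ c * Y t ω) := by
  refine isOptionalProjection_of_setLIntegral ?_ fun T hT A hA hAT ↦ ?_
  · have h₁ := h.optional
    let _ : MeasurableSpace (ℝ≥0 × Ω) := StoppingCompensator.optional 𝓕
    exact h₁.const_mul c
  · change ∫⁻ ω in A, c * stoppedValue Y T ω ∂P = ∫⁻ ω in A, c * stoppedValue X T ω ∂P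
    rw [lintegral_const_mul _ (measurable_stoppedValue_of_uncurry h.measurable_uncurry hT),
      lintegral_const_mul _ (measurable_stoppedValue_of_uncurry hX hT),
      h.setLIntegral_eq hT hA hAT]

/-- Subtraction in `[0, ∞]` is truncated, so `Y_T ≤ 1` must be known; it holds almost surely on `{T
< ∞}` by monotonicity of conditional expectation, which also supplies the finiteness needed to
subtract integrals. -/
lemma IsOptionalProjection.compl {D : Set (ℝ≥0 × Ω)} {Y : ℝ≥0 → Ω → ℝ≥0∞} (hD : MeasurableSet D)
    (h : IsOptionalProjection 𝓕 P (fun t ω ↦ D.indicator 1 (t, ω)) Y) :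
    IsOptionalProjection 𝓕 P (fun t ω ↦ Dᶜ.indicator 1 (t, ω)) (fun t ω ↦ 1 - Y t ω) := by
  have hDm : Measurable (Function.uncurry fun t ω ↦ D.indicator (1 : ℝ≥0 × Ω → ℝ≥0∞) (t, ω)) :=
    measurable_one.indicator hD
  refine isOptionalProjection_of_setLIntegral ?_ fun T hT A hA hAT ↦ ?_
  · have h₁ := h.optional
    let _ : MeasurableSpace (ℝ≥0 × Ω) := StoppingCompensator.optional 𝓕
    exact measurable_const.sub h₁
  · have hY := measurable_stoppedValue_of_uncurry h.measurable_uncurry hT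
    have hle : ∀ᵐ ω ∂P.restrict A, stoppedValue Y T ω ≤ 1 := by
      have hval : valueAt Y T ≤ᵐ[P] 1 := by
        refine (h.condExp T hT).trans_le ?_
        refine (condLExp_mono (Eventually.of_forall fun ω ↦ ?_)).trans
          (Eventually.of_forall (condLExp_one hT.measurableSpace_le P).le)
        exact Set.indicator_le' (fun ω _ ↦ Set.indicator_le_self' (by simp) _) (by simp) ω
      filter_upwards [ae_restrict_of_ae hval, ae_restrict_mem (hT.measurableSpace_le _ hA)]
        with ω hω hωA
      rwa [valueAt, Set.indicator_of_mem (hAT hωA)] at hω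
    have hfin : ∫⁻ ω in A, stoppedValue Y T ω ∂P ≠ ∞ := by
      refine ((lintegral_mono_ae hle).trans_lt ?_).ne
      simp
    have hX : stoppedValue (fun t ω ↦ Dᶜ.indicator (1 : ℝ≥0 × Ω → ℝ≥0∞) (t, ω)) T =
        fun ω ↦ 1 - stoppedValue (fun t ω ↦ D.indicator (1 : ℝ≥0 × Ω → ℝ≥0∞) (t, ω)) T ω := by
      ext ω
      by_cases hω : ((T ω).untopA, ω) ∈ D <;> simp [stoppedValue, hω]
    rw [hX]
    change ∫⁻ ω in A, 1 - stoppedValue Y T ω ∂P = _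
    have hY' : ∫⁻ ω in A, stoppedValue (fun t ω ↦ D.indicator (1 : ℝ≥0 × Ω → ℝ≥0∞) (t, ω)) T ω ∂P ≠ ∞ := by
      rwa [← h.setLIntegral_eq hT hA hAT]
    rw [lintegral_sub hY hfin hle]
    refine Eq.trans ?_ (lintegral_sub (measurable_stoppedValue_of_uncurry hDm hT) hY'
      (Eventually.of_forall fun ω ↦ Set.indicator_le_self' (by simp) _)).symm
    rw [h.setLIntegral_eq hT hA hAT]
    rfl

/-- Dynkin's π-λ theorem applies, since the rectangles `[a, ∞) × B` form a π-system generating the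
product σ-algebra. -/
lemma exists_isOptionalProjection_indicator (h𝓕 : UsualHypotheses 𝓕 P) {D : Set (ℝ≥0 × Ω)}
    (hD : MeasurableSet D) :
    ∃ Y, IsOptionalProjection 𝓕 P (fun t ω ↦ D.indicator 1 (t, ω)) Y := by
  have hgen : (Prod.instMeasurableSpace : MeasurableSpace (ℝ≥0 × Ω)) =
      MeasurableSpace.generateFrom
        (Set.image2 (· ×ˢ ·) (Set.range Set.Ici) {B : Set Ω | MeasurableSet B}) := by
    refine (generateFrom_eq_prod ?_ MeasurableSpace.generateFrom_measurableSet ?_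
      isCountablySpanning_measurableSet).symm
    · rw [← borel_eq_generateFrom_Ici]
      exact (BorelSpace.measurable_eq (α := ℝ≥0)).symm
    · exact ⟨fun _ ↦ Set.Ici 0, fun _ ↦ ⟨0, rfl⟩, by
        ext x
        simp⟩
  induction D, hD using MeasurableSpace.induction_on_inter hgen
    (isPiSystem_Ici.prod MeasurableSpace.isPiSystem_measurableSet) with
  | empty =>
    refine ⟨fun _ _ ↦ 0, isOptionalProjection_of_setLIntegral ?_ fun T hT A hA hAT ↦ ?_⟩
    · exact @measurable_const _ _ _ (optional 𝓕) 0
    · simp [stoppedValue]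
  | basic D hD =>
    obtain ⟨-, ⟨a, rfl⟩, B, hB, rfl⟩ := hD
    exact exists_isOptionalProjection_Ici_prod h𝓕 a hB
  | compl D hD ih =>
    obtain ⟨Y, hY⟩ := ih
    exact ⟨_, hY.compl hD⟩
  | iUnion D hdisj hD ih =>
    choose Y hY using ih
    have heq : (fun (t : ℝ≥0) (ω : Ω) ↦ (⋃ n, D n).indicator (1 : ℝ≥0 × Ω → ℝ≥0∞) (t, ω)) =
        fun t ω ↦ ∑' n, (D n).indicator 1 (t, ω) := by
      ext t ω
      by_cases h : ∃ n, (t, ω) ∈ D n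
      · obtain ⟨n, hn⟩ := h
        rw [tsum_eq_single n fun k hk ↦ Set.indicator_of_notMem
          (fun hk' ↦ Set.disjoint_left.1 (hdisj hk) hk' hn) _, Set.indicator_of_mem hn,
          Set.indicator_of_mem (Set.mem_iUnion.2 ⟨n, hn⟩)]
      · have h' (n : ℕ) : (t, ω) ∉ D n := fun hn ↦ h ⟨n, hn⟩
        simp [h']
    rw [heq]
    exact ⟨_, IsOptionalProjection.tsum (fun n ↦ measurable_one.indicator (hD n)) hY⟩

/-- Every jointly measurable process with values in `[0, ∞]` has an optional projection. -/
theorem exists_isOptionalProjection (h𝓕 : UsualHypotheses 𝓕 P) {X : ℝ≥0 → Ω → ℝ≥0∞}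
    (hX : Measurable (Function.uncurry X)) : ∃ Y, IsOptionalProjection 𝓕 P X Y := by
  have hsimple (f : SimpleFunc (ℝ≥0 × Ω) ℝ≥0) :
      ∃ Y, IsOptionalProjection 𝓕 P (fun t ω ↦ (f (t, ω) : ℝ≥0∞)) Y := by
    induction f using SimpleFunc.induction with
    | const c hs =>
      obtain ⟨Y, hY⟩ := exists_isOptionalProjection_indicator h𝓕 hs
      rename_i D
      have heq : (fun t ω ↦ ((SimpleFunc.piecewise D hs (SimpleFunc.const _ c)
          (SimpleFunc.const _ 0) (t, ω) : ℝ≥0) : ℝ≥0∞)) =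
          fun (t : ℝ≥0) (ω : Ω) ↦ (c : ℝ≥0∞) * D.indicator 1 (t, ω) := by
        ext t ω
        by_cases h : (t, ω) ∈ D <;> simp [h]
      rw [heq]
      exact ⟨_, hY.const_mul (X := fun t ω ↦ D.indicator 1 (t, ω))
        (measurable_one.indicator hs) c⟩
    | @add f g hdisj hf hg =>
      obtain ⟨Y, hY⟩ := hf
      obtain ⟨Y', hY'⟩ := hg
      have heq : (fun t ω ↦ (((f + g) (t, ω) : ℝ≥0) : ℝ≥0∞)) =
          fun (t : ℝ≥0) (ω : Ω) ↦ (f (t, ω) : ℝ≥0∞) + g (t, ω) := by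
        ext t ω
        simp
      rw [heq]
      exact ⟨_, hY.add (measurable_coe_nnreal_ennreal.comp f.measurable) hY'⟩
  -- Writing `X` as a series of finite-valued simple functions replaces a monotone limit by the
  -- countable additivity of projections.
  choose Y hY using fun n ↦ hsimple (SimpleFunc.eapproxDiff (Function.uncurry X) n)
  have heq : X = fun t ω ↦
      ∑' n, (SimpleFunc.eapproxDiff (Function.uncurry X) n (t, ω) : ℝ≥0∞) := by
    ext t ω
    exact (SimpleFunc.tsum_eapproxDiff _ hX (t, ω)).symm
  rw [heq]
  exact ⟨_, IsOptionalProjection.tsum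
    (fun n ↦ measurable_coe_nnreal_ennreal.comp (SimpleFunc.measurable _)) hY⟩

end Existence

/-! ### Cumulative processes -/

section Cumulative

variable {𝓕 : Filtration ℝ≥0 m}

lemma measurable_cumulative {μ : Measure ℝ≥0} [SFinite μ] {Y : ℝ≥0 → Ω → ℝ≥0∞}
    (hY : IsProgressive 𝓕 Y) (t : ℝ≥0) : Measurable[𝓕 t] (cumulative Y μ t) := by
  -- Replacing `s` by `min s t` exhibits the integrand as a function of the restriction of `Y` to
  -- `[0, t] × Ω`, where it is `𝓕 t`-measurable.
  have heq : cumulative Y μ t = fun ω ↦ ∫⁻ s in Set.Ioc 0 t, Y (min s t) ω ∂μ := by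
    ext ω
    refine setLIntegral_congr_fun measurableSet_Ioc fun s hs ↦ ?_
    simp only [min_eq_left hs.2]
  rw [heq]
  have hYt := hY t
  let _ : MeasurableSpace Ω := 𝓕 t
  have h : Measurable fun p : ℝ≥0 × Ω ↦
      ((⟨min p.1 t, Set.mem_Iic.2 (min_le_right _ _)⟩ : Set.Iic t), p.2) :=
    Measurable.prodMk (Measurable.subtype_mk (by fun_prop)) measurable_snd
  exact (hYt.comp h).lintegral_prod_left'

lemma cumulative_eq_withDensity (μ : Measure ℝ≥0) (Y : ℝ≥0 → Ω → ℝ≥0∞) (t : ℝ≥0) (ω : Ω) :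
    cumulative Y μ t ω = μ.withDensity (fun s ↦ Y s ω) (Set.Ioc 0 t) :=
  (withDensity_apply _ measurableSet_Ioc).symm

lemma monotone_cumulative (μ : Measure ℝ≥0) (Y : ℝ≥0 → Ω → ℝ≥0∞) (ω : Ω) :
    Monotone fun t ↦ cumulative Y μ t ω :=
  fun _ _ hst ↦ lintegral_mono_set (Set.Ioc_subset_Ioc_right hst)

/-- This is left-continuity: `(0, t)` is the directed union of the `(0, q]` with `q < t` rational,
and the endpoint `t` carries no mass. No finiteness is needed. -/
lemma cumulative_eq_iSup {μ : Measure ℝ≥0} [NullSingletonClass μ] (Y : ℝ≥0 → Ω → ℝ≥0∞) (t : ℝ≥0) (ω : Ω) :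
    cumulative Y μ t ω = ⨆ q ∈ rationals ∩ Set.Iio t, cumulative Y μ q ω := by
  simp only [cumulative_eq_withDensity]
  rw [← measure_biUnion_eq_iSup (countable_rationals.mono Set.inter_subset_left)]
  · have hunion : ⋃ q ∈ rationals ∩ Set.Iio t, Set.Ioc 0 q = Set.Ioo 0 t := by
      ext x
      simp only [Set.mem_iUnion, Set.mem_Ioc, Set.mem_Ioo, exists_prop, Set.mem_inter_iff,
        Set.mem_Iio]
      constructor
      · rintro ⟨q, ⟨-, hq⟩, hx, hxq⟩
        exact ⟨hx, hxq.trans_lt hq⟩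
      · rintro ⟨hx, hxt⟩
        obtain ⟨n, hn⟩ := ((tendsto_gridSucc x).eventually_lt_const hxt).exists
        exact ⟨_, ⟨gridSucc_mem n x, hn⟩, hx, (lt_gridSucc n x).le⟩
    rw [hunion]
    have h : Set.Ioo 0 t =ᵐ[μ.withDensity fun s ↦ Y s ω] Set.Ioc 0 t :=
      (withDensity_absolutelyContinuous μ _).ae_le Ioo_ae_eq_Ioc
    exact measure_congr h.symm
  · intro q hq q' hq'
    rcases le_total q q' with h | h
    · exact ⟨q', hq', Set.Ioc_subset_Ioc_right h, le_rfl⟩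
    · exact ⟨q, hq, le_rfl, Set.Ioc_subset_Ioc_right h⟩

lemma measurable_predictable_indicator_Ioi {q : ℝ≥0} {h : Ω → ℝ≥0∞} (hh : Measurable[𝓕 q] h) :
    Measurable[𝓕.predictable] ((Set.Ioi q ×ˢ Set.univ).indicator fun p : ℝ≥0 × Ω ↦ h p.2) := by
  intro S hS
  have hq : MeasurableSet[𝓕.predictable] (Set.Ioi q ×ˢ (Set.univ : Set Ω)) :=
    measurableSet_predictable_Ioi_prod (@MeasurableSet.univ _ (𝓕 q))
  rw [Set.indicator_preimage, Set.ite]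
  refine MeasurableSet.union ?_ (MeasurableSet.diff ?_ hq)
  · convert! measurableSet_predictable_Ioi_prod (hh hS) using 1
    ext p
    simp [and_comm]
  · exact @measurable_zero _ _ _ 𝓕.predictable _ S hS

/-- By left-continuity the process is the countable supremum of `1_{t > q} A_q` over rational `q`,
with `A_q` being `𝓕 q`-measurable; each such process is predictable. -/
lemma isStronglyPredictable_cumulative {μ : Measure ℝ≥0} [SFinite μ] [NullSingletonClass μ]
    {Y : ℝ≥0 → Ω → ℝ≥0∞} (hY : IsProgressive 𝓕 Y) :
    IsStronglyPredictable 𝓕 (cumulative Y μ) := by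
  have heq : Function.uncurry (cumulative Y μ) = fun p : ℝ≥0 × Ω ↦ ⨆ q ∈ rationals,
      (Set.Ioi q ×ˢ Set.univ).indicator (fun p : ℝ≥0 × Ω ↦ cumulative Y μ q p.2) p := by
    ext ⟨t, ω⟩
    simp only [Function.uncurry_apply_pair]
    rw [cumulative_eq_iSup]
    simp only [Set.mem_inter_iff, Set.mem_Iio, iSup_and]
    refine iSup_congr fun q ↦ iSup_congr fun _ ↦ ?_
    by_cases h : q < t <;> simp [h]
  rw [IsStronglyPredictable, heq]
  refine Measurable.stronglyMeasurable ?_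
  exact Measurable.biSup _ countable_rationals fun q _ ↦
    measurable_predictable_indicator_Ioi (measurable_cumulative hY q)

/-- Right-continuity is continuity from above of a measure along `(0, r] ↓ (0, t]`, which is where
finiteness enters. -/
lemma continuousWithinAt_cumulative {μ : Measure ℝ≥0} {Y : ℝ≥0 → Ω → ℝ≥0∞} {ω : Ω}
    (hfin : ∀ t, cumulative Y μ t ω < ∞) (t : ℝ≥0) :
    ContinuousWithinAt (fun s ↦ cumulative Y μ s ω) (Set.Ici t) t := by
  simp only [cumulative_eq_withDensity] at hfin ⊢
  rw [← continuousWithinAt_Ioi_iff_Ici]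
  have h := tendsto_measure_biInter_gt (μ := μ.withDensity fun s ↦ Y s ω)
    (s := fun r ↦ Set.Ioc 0 r) (a := t) (fun _ _ ↦ measurableSet_Ioc.nullMeasurableSet)
    (fun _ _ _ hij ↦ Set.Ioc_subset_Ioc_right hij) ⟨t + 1, by simp, (hfin _).ne⟩
  have hinter : ⋂ r > t, Set.Ioc 0 r = Set.Ioc 0 t := by
    ext x
    simp only [Set.mem_iInter, Set.mem_Ioc]
    refine ⟨fun hx ↦ ⟨(hx (t + 1) (by simp)).1, le_of_forall_gt_imp_ge_of_dense fun r hr ↦ (hx r hr).2⟩,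
      fun hx r hr ↦ ⟨hx.1, hx.2.trans (le_of_lt hr)⟩⟩
  rw [hinter] at h
  exact h

lemma cumulative_add_increment (μ : Measure ℝ≥0) (Y : ℝ≥0 → Ω → ℝ≥0∞) {s t : ℝ≥0} (hst : s ≤ t)
    (ω : Ω) :
    cumulative Y μ t ω = cumulative Y μ s ω + ∫⁻ u in Set.Ioc s t, Y u ω ∂μ := by
  rw [cumulative, ← Set.Ioc_union_Ioc_eq_Ioc zero_le hst,
    lintegral_union measurableSet_Ioc (Set.Ioc_disjoint_Ioc_of_le le_rfl)]
  rfl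

/-! ### Transfer of the compensator to the smaller filtration -/

variable {P : Measure Ω} [IsProbabilityMeasure P]

lemma IsOptionalProjection.setLIntegral_eq_of_le {X Y : ℝ≥0 → Ω → ℝ≥0∞}
    (h : IsOptionalProjection 𝓕 P X Y) {s t : ℝ≥0} (hst : s ≤ t) {B : Set Ω}
    (hB : MeasurableSet[𝓕 s] B) : ∫⁻ ω in B, Y t ω ∂P = ∫⁻ ω in B, X t ω ∂P := by
  refine h.setLIntegral_eq (isStoppingTime_const 𝓕 t) (A := B) ?_ (fun _ _ ↦ WithTop.coe_lt_top t)
  rw [IsStoppingTime.measurableSpace_const]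
  exact 𝓕.mono hst _ hB

/-- After Tonelli, each `u ∈ (s, t]` contributes the projection identity at the constant time `u`,
on `B ∈ 𝓕 s ⊆ 𝓕 u`. -/
lemma IsOptionalProjection.setLIntegral_increment_eq {μ : Measure ℝ≥0} [SFinite μ]
    {X Y : ℝ≥0 → Ω → ℝ≥0∞} (hX : Measurable (Function.uncurry X))
    (h : IsOptionalProjection 𝓕 P X Y) {s : ℝ≥0} (t : ℝ≥0) {B : Set Ω}
    (hB : MeasurableSet[𝓕 s] B) :
    ∫⁻ ω in B, ∫⁻ u in Set.Ioc s t, Y u ω ∂μ ∂P = ∫⁻ ω in B, ∫⁻ u in Set.Ioc s t, X u ω ∂μ ∂P := by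
  rw [lintegral_lintegral_swap (f := fun ω u ↦ Y u ω)
      (h.measurable_uncurry.comp measurable_swap).aemeasurable,
    lintegral_lintegral_swap (f := fun ω u ↦ X u ω) (hX.comp measurable_swap).aemeasurable]
  exact setLIntegral_congr_fun measurableSet_Ioc fun u hu ↦ h.setLIntegral_eq_of_le hu.1.le hB

lemma IsOptionalProjection.lintegral_cumulative_eq {μ : Measure ℝ≥0} [SFinite μ]
    {X Y : ℝ≥0 → Ω → ℝ≥0∞} (hX : Measurable (Function.uncurry X))
    (h : IsOptionalProjection 𝓕 P X Y) (t : ℝ≥0) :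
    ∫⁻ ω, cumulative Y μ t ω ∂P = ∫⁻ ω, cumulative X μ t ω ∂P := by
  simpa [cumulative] using h.setLIntegral_increment_eq (μ := μ) hX t (@MeasurableSet.univ _ (𝓕 0))

lemma integrable_jumpProcess {R : Ω → WithTop ℝ≥0} (hR : IsStoppingTime 𝓕 R) (t : ℝ≥0) :
    Integrable (jumpProcess R t) P :=
  (integrable_const 1).indicator (𝓕.le t _ (hR t))

/-- `A_t` is the difference of the bounded jump process and an integrable martingale. Almost sure
finiteness is essential here because `toReal` sends `∞` to `0`. -/
lemma IsCompensator.lintegral_ne_top {R : Ω → WithTop ℝ≥0} {A : ℝ≥0 → Ω → ℝ≥0∞}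
    (hR : IsStoppingTime 𝓕 R) (hA : IsCompensator 𝓕 P R A) (t : ℝ≥0) :
    ∫⁻ ω, A t ω ∂P ≠ ∞ := by
  have hint : Integrable (fun ω ↦ (A t ω).toReal) P := by
    refine ((integrable_jumpProcess hR t).sub (hA.martingale.integrable t)).congr
      (Eventually.of_forall fun ω ↦ ?_)
    simp
  refine (integrable_toReal_iff ?_ (hA.finite.mono fun ω hω ↦ (hω t).ne)).1 hint
  exact ((hA.predictable.stronglyAdapted t).measurable.mono (𝓕.le t) le_rfl).aemeasurable

variable {𝓖 : Filtration ℝ≥0 m} {R : Ω → WithTop ℝ≥0} {μ : Measure ℝ≥0} [SFinite μ] [NullSingletonClass μ]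
  {X Y : ℝ≥0 → Ω → ℝ≥0∞}

/-- If `∫ X dμ` is the compensator of `R` in the larger filtration, then the integral of an optional
projection of `X` is its compensator in the smaller one. -/
theorem IsOptionalProjection.isCompensator_cumulative (hsub : 𝓕 ≤ 𝓖)
    (hX : Measurable (Function.uncurry X)) (h : IsOptionalProjection 𝓕 P X Y)
    (hR : IsStoppingTime 𝓕 R) (hA : IsCompensator 𝓖 P R (cumulative X μ)) :
    IsCompensator 𝓕 P R (cumulative Y μ) := by
  have hprog : IsProgressive 𝓕 Y := isProgressive_of_optional h.optional
  have hR𝓖 : IsStoppingTime 𝓖 R := fun t ↦ hsub t _ (hR t)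
  have hXtop (t : ℝ≥0) : ∫⁻ ω, cumulative X μ t ω ∂P ≠ ∞ := hA.lintegral_ne_top hR𝓖 t
  have hYtop (t : ℝ≥0) : ∫⁻ ω, cumulative Y μ t ω ∂P ≠ ∞ := by
    rw [h.lintegral_cumulative_eq hX]
    exact hXtop t
  have hYmeas (t : ℝ≥0) : Measurable (cumulative Y μ t) :=
    (measurable_cumulative hprog t).mono (𝓕.le t) le_rfl
  have hXmeas (t : ℝ≥0) : Measurable (cumulative X μ t) :=
    (hA.predictable.stronglyAdapted t).measurable.mono (𝓖.le t) le_rfl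
  have hfin : ∀ᵐ ω ∂P, ∀ t, cumulative Y μ t ω < ∞ := by
    have hn : ∀ᵐ ω ∂P, ∀ n : ℕ, cumulative Y μ n ω < ∞ :=
      ae_all_iff.2 fun n ↦ ae_lt_top (hYmeas n) (hYtop n)
    filter_upwards [hn] with ω hω t
    obtain ⟨n, hn⟩ := exists_nat_ge t
    exact (monotone_cumulative μ Y ω hn).trans_lt (hω n)
  have hint {Z : ℝ≥0 → Ω → ℝ≥0∞} {t : ℝ≥0} (hm : Measurable (cumulative Z μ t))
      (htop : ∫⁻ ω, cumulative Z μ t ω ∂P ≠ ∞) :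
      Integrable (fun ω ↦ (cumulative Z μ t ω).toReal) P :=
    integrable_toReal_of_lintegral_ne_top hm.aemeasurable htop
  -- The martingale property concerns real-valued differences, while the projection identity
  -- concerns `[0, ∞]`-valued increments; integrability makes the two interchangeable.
  have hincr {Z : ℝ≥0 → Ω → ℝ≥0∞} (hm : ∀ t, Measurable (cumulative Z μ t))
      (htop : ∀ t, ∫⁻ ω, cumulative Z μ t ω ∂P ≠ ∞) {s t : ℝ≥0} (hst : s ≤ t) (B : Set Ω) :
      ∫ ω in B, (cumulative Z μ t ω).toReal ∂P - ∫ ω in B, (cumulative Z μ s ω).toReal ∂P =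
        (∫⁻ ω in B, ∫⁻ u in Set.Ioc s t, Z u ω ∂μ ∂P).toReal := by
    have hB (t : ℝ≥0) : ∫⁻ ω in B, cumulative Z μ t ω ∂P ≠ ∞ :=
      ((setLIntegral_le_lintegral _ _).trans_lt (htop t).lt_top).ne
    have hB' (t : ℝ≥0) : ∫ ω in B, (cumulative Z μ t ω).toReal ∂P =
        (∫⁻ ω in B, cumulative Z μ t ω ∂P).toReal :=
      integral_toReal (hm t).aemeasurable (ae_lt_top (hm t) (hB t))
    have hadd : ∫⁻ ω in B, cumulative Z μ t ω ∂P = ∫⁻ ω in B, cumulative Z μ s ω ∂P +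
        ∫⁻ ω in B, ∫⁻ u in Set.Ioc s t, Z u ω ∂μ ∂P := by
      rw [← lintegral_add_left (hm s)]
      simp only [cumulative_add_increment μ Z hst]
    have hle : ∫⁻ ω in B, ∫⁻ u in Set.Ioc s t, Z u ω ∂μ ∂P ≠ ∞ :=
      ((le_add_self.trans_eq hadd.symm).trans_lt (hB t).lt_top).ne
    rw [hB', hB', hadd, ENNReal.toReal_add (hB s) hle, add_sub_cancel_left]
  have hadapted : StronglyAdapted 𝓕 fun t ω ↦ jumpProcess R t ω - (cumulative Y μ t ω).toReal := by
    refine fun t ↦ Measurable.stronglyMeasurable ?_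
    have h₁ := hR t
    have h₂ := measurable_cumulative (μ := μ) hprog t
    let _ : MeasurableSpace Ω := 𝓕 t
    exact (measurable_one.indicator h₁).sub h₂.ennreal_toReal
  refine ⟨isStronglyPredictable_cumulative hprog, hfin, ?_, ?_, ?_, hadapted, fun s t hst ↦ ?_⟩
  · exact Eventually.of_forall fun ω ↦ by simp [cumulative]
  · exact Eventually.of_forall fun ω ↦ monotone_cumulative μ Y ω
  · filter_upwards [hfin] with ω hω
    exact continuousWithinAt_cumulative hω
  · have hJ (t : ℝ≥0) : Integrable (jumpProcess R t) P := integrable_jumpProcess hR t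
    have hYint (t : ℝ≥0) := hint (hYmeas t) (hYtop t)
    have hXint (t : ℝ≥0) := hint (hXmeas t) (hXtop t)
    refine (ae_eq_condExp_of_forall_setIntegral_eq (𝓕.le s) ((hJ t).sub (hYint t))
      (fun B _ _ ↦ ((hJ s).sub (hYint s)).integrableOn) (fun B hB _ ↦ ?_)
      (hadapted s).aestronglyMeasurable).symm
    -- An event of `𝓕 s` is an event of `𝓖 s`, so the larger martingale can be tested on it; its
    -- compensator increment is then exchanged for that of `Y`.
    have h𝓖 := hA.martingale.setIntegral_eq hst (hsub s _ hB)
    have hYX := h.setLIntegral_increment_eq (μ := μ) hX t hB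
    have h₁ := hincr hXmeas hXtop hst B
    have h₂ := hincr hYmeas hYtop hst B
    rw [integral_sub (hJ s).integrableOn (hXint s).integrableOn,
      integral_sub (hJ t).integrableOn (hXint t).integrableOn] at h𝓖
    change ∫ ω in B, jumpProcess R s ω - (cumulative Y μ s ω).toReal ∂P =
      ∫ ω in B, jumpProcess R t ω - (cumulative Y μ t ω).toReal ∂P
    rw [integral_sub (hJ s).integrableOn (hYint s).integrableOn,
      integral_sub (hJ t).integrableOn (hYint t).integrableOn]
    rw [hYX] at h₂
    linarith

end Cumulative

/-- The mass of a point is the jump of `c` there, which vanishes by continuity. -/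
lemma nullSingletonClass_clockMeasure {c : ℝ≥0 → ℝ} (hc : Continuous c) (hmono : Monotone c) :
    NullSingletonClass (clockMeasure c hc hmono) := by
  refine ⟨fun t ↦ ?_⟩
  rw [clockMeasure, StieltjesFunction.measure_singleton]
  have h : Function.leftLim c t = c t := hc.continuousAt.continuousWithinAt.leftLim_eq
  change ENNReal.ofReal (c t - Function.leftLim c t) = 0
  rw [h, sub_self, ENNReal.ofReal_zero]

end StoppingCompensator

/-! ### The main theorem -/

theorem theoremt3 {Ω : Type*} {m : MeasurableSpace Ω} (P : Measure Ω) [IsProbabilityMeasure P]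
    (𝓕 𝓖 : Filtration ℝ≥0 m)
    (h𝓖 : StoppingCompensator.UsualHypotheses 𝓖 P)
    (h𝓕 : StoppingCompensator.UsualHypotheses 𝓕 P)
    (hsub : 𝓕 ≤ 𝓖)
    (c : ℝ≥0 → ℝ) (hc : Continuous c) (hmono : Monotone c)
    (lam : ℝ≥0 → Ω → ℝ≥0∞) (hmeas : Measurable (Function.uncurry lam)) (hadap : Adapted 𝓖 lam)
    (R : Ω → WithTop ℝ≥0) (hR𝓖 : IsStoppingTime 𝓖 R) (hR𝓕 : IsStoppingTime 𝓕 R)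
    (hcomp : StoppingCompensator.IsCompensator 𝓖 P R
      (StoppingCompensator.cumulative lam (StoppingCompensator.clockMeasure c hc hmono))) :
    (∃ olam : ℝ≥0 → Ω → ℝ≥0∞, StoppingCompensator.IsOptionalProjection 𝓕 P lam olam) ∧
    ∀ olam : ℝ≥0 → Ω → ℝ≥0∞, StoppingCompensator.IsOptionalProjection 𝓕 P lam olam →
      StoppingCompensator.IsCompensator 𝓕 P R
        (StoppingCompensator.cumulative olam
          (StoppingCompensator.clockMeasure c hc hmono)) := by
  have := StoppingCompensator.nullSingletonClass_clockMeasure hc hmono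
  have : SFinite (StoppingCompensator.clockMeasure c hc hmono) := by
    rw [StoppingCompensator.clockMeasure]
    infer_instance
  exact ⟨StoppingCompensator.exists_isOptionalProjection h𝓕 hmeas,
    fun _ h ↦ h.isCompensator_cumulative hsub hmeas hR𝓕 hcomp⟩
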